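/- Let $Q$ be a commutative Noetherian ring which is either (a) local, with maximal ideal $\mathfrak m$, or (b) graded, $Q=\bigoplus_{n\ge 0}Q_n$ with $Q_0$ local with maximal ideal $\mathfrak m_0$ (for instance $Q_0$ a field), and $\mathfrak m=\mathfrak m_0\oplus\bigoplus_{n\ge1}Q_n$. Let $\underline g=g_1,\dots,g_s$ be a regular sequence in $Q$ (so $(\underline g)\neq Q$), consisting of homogeneous elements in case (b). A finitely generated $Q$-module $M$ is called a *$\underline g$-weak complete intersection module* if it has a free resolution $(F,\partial)$ with $\operatorname{Im}\partial_i\subseteq(\underline g)F_{i-1}$ for all $i\geq 1$; an ideal $I\subseteq Q$ is called a *$\underline g$-weak complete intersection ideal* if $Q/I$ is such a module. A proper ideal $I$ (homogeneous in case (b)) is called a *weak complete intersection ideal* if the minimal free resolution (the minimal graded free resolution in case (b)) $(F,\partial)$ of $Q/I$ satisfies $\operatorname{Im}\partial_i\subseteq I F_{i-1}$ for all $i\ge1$; here a free resolution by finitely generated modules is minimal if $\operatorname{Im}\partial_i\subseteq\mathfrak m F_{i-1}$ for all $i\geq 1$. A *complete intersection ideal* is an ideal generated by a regular sequence (of homogeneous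 elements in case (b)); the empty sequence is allowed. 1. Every finitely generated $\underline g$-weak complete intersection module $M$ has finite projective dimension; more precisely, $\operatorname{pd}_Q M\le s$. 2. Let $I$ be a weak complete intersection ideal. Then $I$ is a $\underline g$-weak complete intersection ideal if and only if $I$ is a complete intersection ideal and $I\subseteq(\underline g)$. -/

import Mathlib

open CategoryTheory

universe u v

/-- A free resolution `⋯ ⟶ F₁ ⟶ F₀ ⟶ M ⟶ 0`: a projective resolution of `M` (in Mathlib's sense)
all of whose terms are free modules. -/
def IsFreeResolution {Q : Type u} [CommRing Q] {M : ModuleCat.{v} Q}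
    (F : ProjectiveResolution M) : Prop :=
  ∀ n : ℕ, Module.Free Q (F.complex.X n)

/-- All differentials `∂ : F_{n+1} ⟶ F_n` have their image in `J F_n`. -/
def DifferentialsLandIn {Q : Type u} [CommRing Q] {M : ModuleCat.{v} Q}
    (F : ProjectiveResolution M) (J : Ideal Q) : Prop :=
  ∀ n : ℕ, LinearMap.range (F.complex.d (n + 1) n).hom ≤
    J • (⊤ : Submodule Q (F.complex.X n))

/-- `F` is a free resolution by finitely generated modules which is minimal with respect to the
ideal `m`: its differentials vanish modulo `m`. It is used for the maximal ideal of a local ring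
and for the homogeneous maximal ideal of a graded ring. -/
def IsMinimalFreeResolution {Q : Type u} [CommRing Q] (m : Ideal Q) {M : ModuleCat.{v} Q}
    (F : ProjectiveResolution M) : Prop :=
  IsFreeResolution F ∧ (∀ n : ℕ, Module.Finite Q (F.complex.X n)) ∧ DifferentialsLandIn F m

/-- A finitely generated module `M` is a `g`-weak complete intersection module if it has a free
resolution whose differentials land in `(g) F`. -/
def IsSeqWeakCIModule {Q : Type u} [CommRing Q] (g : List Q)
    (M : Type v) [AddCommGroup M] [Module Q M] : Prop :=
  Module.Finite Q M ∧ ∃ F : ProjectiveResolution (ModuleCat.of Q M),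
    IsFreeResolution F ∧ DifferentialsLandIn F (Ideal.ofList g)

/-- `I` is a `g`-weak complete intersection ideal if `Q / I` is a `g`-weak complete intersection
module. -/
def IsSeqWeakCIIdeal {Q : Type u} [CommRing Q] (g : List Q) (I : Ideal Q) : Prop :=
  IsSeqWeakCIModule g (Q ⧸ I)

section LocalCase

/-- An ideal `I` of a local ring is a weak complete intersection ideal if the differentials of the
minimal free resolution `F` of `Q / I` land in `I F`. -/
def IsWeakCIIdeal {Q : Type u} [CommRing Q] [IsLocalRing Q] (I : Ideal Q) : Prop :=
  ∃ F : ProjectiveResolution (ModuleCat.of Q (Q ⧸ I)),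
    IsMinimalFreeResolution (IsLocalRing.maximalIdeal Q) F ∧ DifferentialsLandIn F I

/-- A complete intersection ideal is an ideal generated by a regular sequence. -/
def IsCIIdeal {Q : Type u} [CommRing Q] (I : Ideal Q) : Prop :=
  ∃ f : List Q, RingTheory.Sequence.IsRegular Q f ∧ Ideal.ofList f = I

end LocalCase

section GradedCase

/-- The component of degree `d : ℤ` of an `ℕ`-graded ring; it is zero in negative degrees. -/
def gradedComponent {Q : Type u} [CommRing Q] (𝒜 : ℕ → AddSubgroup Q) : ℤ → AddSubgroup Q
  | Int.ofNat n => 𝒜 n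
  | Int.negSucc _ => ⊥

/-- The homogeneous maximal ideal `m₀ ⊕ Q₁ ⊕ Q₂ ⊕ ⋯` of an `ℕ`-graded ring `Q` such that `Q₀` is
local with maximal ideal `m₀`. -/
noncomputable def gradedMaximalIdeal {Q : Type u} [CommRing Q] (𝒜 : ℕ → AddSubgroup Q)
    [GradedRing 𝒜] [IsLocalRing (𝒜 0)] : Ideal Q :=
  (IsLocalRing.maximalIdeal (𝒜 0)).comap (GradedRing.projZeroRingHom' 𝒜)

/-- A structure of graded free resolution, with finitely generated terms, on a resolution `F` of
`Q / I`: each `F_n` has a finite basis whose members carry degrees in `ℤ`, that is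
`F_n = ⨁ⱼ Q(-deg n j)`, such that the differentials and the augmentation `F₀ ⟶ Q / I` are
homogeneous of degree `0`. -/
structure GradedFreeStructure {Q : Type u} [CommRing Q] (𝒜 : ℕ → AddSubgroup Q) (I : Ideal Q)
    (F : ProjectiveResolution (ModuleCat.of Q (Q ⧸ I))) where
  rank : ℕ → ℕ
  basis : ∀ n : ℕ, Module.Basis (Fin (rank n)) Q (F.complex.X n)
  deg : ∀ n : ℕ, Fin (rank n) → ℤ
  differential_homogeneous : ∀ (n : ℕ) (j : Fin (rank (n + 1))) (i : Fin (rank n)),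
    (basis n).repr ((F.complex.d (n + 1) n).hom (basis (n + 1) j)) i ∈
      gradedComponent 𝒜 (deg (n + 1) j - deg n i)
  augmentation_homogeneous : ∀ j : Fin (rank 0), ∃ q ∈ gradedComponent 𝒜 (deg 0 j),
    (show Q ⧸ I from (F.π.f 0).hom (basis 0 j)) = Ideal.Quotient.mk I q

/-- A homogeneous ideal `I` of a graded ring is a weak complete intersection ideal if the
differentials of the minimal graded free resolution `F` of `Q / I` land in `I F`. -/
def IsGradedWeakCIIdeal {Q : Type u} [CommRing Q] (𝒜 : ℕ → AddSubgroup Q)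
    [GradedRing 𝒜] [IsLocalRing (𝒜 0)] (I : Ideal Q) : Prop :=
  I.IsHomogeneous 𝒜 ∧ ∃ F : ProjectiveResolution (ModuleCat.of Q (Q ⧸ I)),
    Nonempty (GradedFreeStructure 𝒜 I F) ∧
      IsMinimalFreeResolution (gradedMaximalIdeal 𝒜) F ∧ DifferentialsLandIn F I

/-- A homogeneous regular sequence: a regular sequence of homogeneous elements. -/
def IsHomogeneousRegular {Q : Type u} [CommRing Q] (𝒜 : ℕ → AddSubgroup Q) (f : List Q) : Prop :=
  RingTheory.Sequence.IsRegular Q f ∧ ∀ x ∈ f, SetLike.IsHomogeneousElem 𝒜 x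

/-- In a graded ring, a complete intersection ideal is an ideal generated by a homogeneous regular
sequence. -/
def IsGradedCIIdeal {Q : Type u} [CommRing Q] (𝒜 : ℕ → AddSubgroup Q) (I : Ideal Q) : Prop :=
  ∃ f : List Q, IsHomogeneousRegular 𝒜 f ∧ Ideal.ofList f = I

end GradedCase

/-!
Let `F` be a free resolution. The whole argument rests on exactness of `F` modulo a weakly regular
sequence `rs` of length `k`: a chain of degree `> k` whose boundary lies in `(rs) F` is a boundary
modulo `(rs) F` (`exact_mod_of_isWeaklyRegular`). This is the vanishing of `Tor_i (-, Q / (rs))` for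
`i > k`, proved by a diagram chase. If the differentials of `F` land in `(g) F`, it gives
`F_i = (g) F_i`, hence `F_i = 0`, for `i > g.length`; this bounds the projective dimension.

Now let `I` be a weak complete intersection ideal with minimal resolution `F`. If `I ≤ (g)`, then
`F` itself shows that `I` is a `g`-weak complete intersection ideal. Conversely, if `G` is a free
resolution of `Q / I` with differentials in `(g)`, then `I G₀ ⊆ (g) G₀` forces `I ≤ (g)`, and so
`F` is bounded by the first part. Let `f₁, …, f_r` be the generators of `I` read off from a basis of
`F₁`, and let `p` be the largest degree with `F_p ≠ 0`.

* `r ≤ p` (`nontrivial_of_relations`). Let `σ_j` be a null-homotopy of multiplication by `f_j` on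
  `F`. Since the differential lands in `I F`, its `f_j`-coefficient modulo the maximal ideal `m` is
  an operator `D_j` on `F / m F`, and `∂ σ_l + σ_l ∂ = f_l` becomes the Clifford relation
  `D_j σ_l + σ_l D_j = δ_{jl}`. Hence `σ_1 ⋯ σ_r e ≠ 0` in `F_r / m F_r`, where `e` generates `F₀`.
* `I` has grade at least `p` (`mem_ofList_of_forall_mul_mem`). If `rs` is weakly regular of length
  less than `p` and `y I ⊆ (rs)`, then `y` maps `F_p` to chains with boundary in `(rs) F`, so
  `y F_p ⊆ (rs) F_p` and `y ∈ (rs)`.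

As `I` has `r` generators and grade at least `r`, prime avoidance for cosets yields a weakly regular
sequence `x₁, …, x_r` with `x_k ∈ f_k + (f_{k+1}, …, f_r)`, which generates `I`. This settles the
local case. In the graded case the `x_k` are not homogeneous, but the `f_k` are. In the localization
at the homogeneous maximal ideal, `x_r, …, x_1` is again regular, and `f_k` agrees with `x_k` modulo
`(x_{k+1}, …, x_r) = (f_{k+1}, …, f_r)`, so `f_r, …, f_1` is regular there; by homogeneity it is
regular in `Q`.
-/

/-! ### Ideal multiples of free modules -/

lemma Module.Basis.mem_ideal_smul_top_iff_repr {Q : Type*} [CommRing Q] {ι X : Type*}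
    [AddCommGroup X] [Module Q X] (b : Module.Basis ι Q X) (J : Ideal Q) (x : X) :
    x ∈ J • (⊤ : Submodule Q X) ↔ ∀ i, b.repr x i ∈ J := by
  constructor
  · intro hx i
    refine Submodule.smul_induction_on hx (fun a ha y _ => ?_) (fun y z hy hz => ?_)
    · simpa using J.mul_mem_right _ ha
    · simpa using J.add_mem hy hz
  · intro h
    rw [← b.linearCombination_repr x, Finsupp.linearCombination_apply]
    exact Submodule.sum_mem _ fun i _ => Submodule.smul_mem_smul (h i) trivial

lemma mem_ideal_smul_top_of_smul_mem {Q : Type*} [CommRing Q] {X : Type*} [AddCommGroup X]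
    [Module Q X] [Module.Free Q X] {J J' : Ideal Q} {r : Q} (h : ∀ a, r * a ∈ J → a ∈ J')
    {x : X} (hx : r • x ∈ J • (⊤ : Submodule Q X)) : x ∈ J' • (⊤ : Submodule Q X) := by
  let b := Module.Free.chooseBasis Q X
  rw [b.mem_ideal_smul_top_iff_repr] at hx ⊢
  exact fun i => h _ (by simpa using hx i)

lemma subsingleton_of_ideal_smul_top_eq_top {Q : Type*} [CommRing Q] {X : Type*} [AddCommGroup X]
    [Module Q X] [Module.Free Q X] {J : Ideal Q} (hJ : J ≠ ⊤)
    (h : ∀ x : X, x ∈ J • (⊤ : Submodule Q X)) : Subsingleton X := by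
  let b := Module.Free.chooseBasis Q X
  have : IsEmpty (Module.Free.ChooseBasisIndex Q X) := ⟨fun i => hJ <| J.eq_top_iff_one.2 <| by
    simpa using (b.mem_ideal_smul_top_iff_repr J (b i)).1 (h _) i⟩
  exact b.repr.toEquiv.subsingleton

lemma mem_of_forall_smul_mem_ideal_smul_top {Q : Type*} [CommRing Q] {X : Type*} [AddCommGroup X]
    [Module Q X] [Module.Free Q X] [Nontrivial X] {J : Ideal Q} {a : Q}
    (h : ∀ x : X, a • x ∈ J • (⊤ : Submodule Q X)) : a ∈ J := by
  let b := Module.Free.chooseBasis Q X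
  obtain ⟨i⟩ := b.index_nonempty
  simpa using (b.mem_ideal_smul_top_iff_repr J _).1 (h (b i)) i

lemma map_mem_ideal_smul_top {Q : Type*} [CommRing Q] {X Y : Type*} [AddCommGroup X]
    [Module Q X] [AddCommGroup Y] [Module Q Y] (f : X →ₗ[Q] Y) {J : Ideal Q} {x : X}
    (hx : x ∈ J • (⊤ : Submodule Q X)) : f x ∈ J • (⊤ : Submodule Q Y) := by
  have := Submodule.mem_map_of_mem (f := f) hx
  rw [Submodule.map_smul''] at this
  exact Submodule.smul_mono le_rfl le_top this

lemma map_mem_mul_smul_top {Q : Type*} [CommRing Q] {X Y : Type*} [AddCommGroup X]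
    [Module Q X] [AddCommGroup Y] [Module Q Y] (f : X →ₗ[Q] Y) {J K : Ideal Q}
    (hf : LinearMap.range f ≤ K • (⊤ : Submodule Q Y)) {x : X}
    (hx : x ∈ J • (⊤ : Submodule Q X)) : f x ∈ (J * K) • (⊤ : Submodule Q Y) := by
  have := Submodule.mem_map_of_mem (f := f) hx
  rw [Submodule.map_smul''] at this
  rw [Submodule.mul_smul]
  exact Submodule.smul_mono le_rfl (by rwa [Submodule.map_top]) this

/-! ### Complexes of free modules and weakly regular sequences -/

section Complex

variable {Q : Type*} [CommRing Q] {X : ℕ → Type*} [∀ n, AddCommGroup (X n)]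
  [∀ n, Module Q (X n)]

/-- A complex of free modules that is exact in positive degrees remains exact modulo a weakly
regular sequence `rs` in all degrees greater than the length of `rs`. -/
lemma exact_mod_of_isWeaklyRegular [∀ n, Module.Free Q (X n)] {d : ∀ n, X (n + 1) →ₗ[Q] X n}
    (hdd : ∀ n x, d n (d (n + 1) x) = 0) (hex : ∀ n x, d n x = 0 → ∃ y, d (n + 1) y = x)
    {rs : List Q} (hrs : RingTheory.Sequence.IsWeaklyRegular Q rs) {n : ℕ} (hn : rs.length ≤ n)
    {x : X (n + 1)} (hx : d n x ∈ Ideal.ofList rs • (⊤ : Submodule Q (X n))) :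
    ∃ y, x - d (n + 1) y ∈ Ideal.ofList rs • (⊤ : Submodule Q (X (n + 1))) := by
  -- Peel off the last element `r`: it is a nonzerodivisor modulo the previous ones.
  induction rs using List.reverseRecOn generalizing n with
  | nil =>
    obtain ⟨y, hy⟩ := hex n x (by simpa using hx)
    exact ⟨y, by simp [hy]⟩
  | append_singleton rs r ih =>
    rw [RingTheory.Sequence.isWeaklyRegular_append_iff,
      RingTheory.Sequence.isWeaklyRegular_singleton_iff,
      isSMulRegular_quotient_iff_mem_of_smul_mem] at hrs
    obtain ⟨hrs, hr⟩ := hrs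
    have hr' : ∀ a, r * a ∈ Ideal.ofList rs → a ∈ Ideal.ofList rs := by simpa using hr
    rw [List.length_append, List.length_singleton] at hn
    obtain ⟨n, rfl⟩ : ∃ m, n = m + 1 := ⟨n - 1, by omega⟩
    rw [Ideal.ofList_append, Ideal.ofList_singleton, Submodule.sup_smul,
      Submodule.ideal_span_singleton_smul] at hx
    obtain ⟨a, ha, b, hb, hab⟩ := Submodule.mem_sup.1 hx
    obtain ⟨y, -, rfl⟩ := (Submodule.mem_smul_pointwise_iff_exists _ _ _).1 hb
    have hdy : d n y ∈ Ideal.ofList rs • (⊤ : Submodule Q (X n)) := by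
      refine mem_ideal_smul_top_of_smul_mem hr' ?_
      have h0 : d n a + r • d n y = 0 := by
        rw [← map_smul, ← map_add, hab, hdd]
      rw [← neg_eq_of_add_eq_zero_right h0]
      exact neg_mem (map_mem_ideal_smul_top _ ha)
    obtain ⟨w, hw⟩ := ih hrs (by omega) hdy
    obtain ⟨z, hz⟩ := ih (n := n + 1) hrs (by omega) (x := x - r • w) (by
      rw [map_sub, map_smul, ← hab, add_sub_assoc, ← smul_sub]
      exact add_mem ha (Submodule.smul_mem _ _ hw))
    refine ⟨z, ?_⟩
    rw [Ideal.ofList_append, Ideal.ofList_singleton, Submodule.sup_smul,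
      Submodule.ideal_span_singleton_smul]
    refine Submodule.mem_sup.2 ⟨_, hz, r • w,
      Submodule.smul_mem_pointwise_smul _ _ _ trivial, by abel⟩

lemma subsingleton_of_range_le_isWeaklyRegular [∀ n, Module.Free Q (X n)]
    {d : ∀ n, X (n + 1) →ₗ[Q] X n}
    (hdd : ∀ n x, d n (d (n + 1) x) = 0) (hex : ∀ n x, d n x = 0 → ∃ y, d (n + 1) y = x)
    {rs : List Q} (hrs : RingTheory.Sequence.IsWeaklyRegular Q rs) (htop : Ideal.ofList rs ≠ ⊤)
    (hd : ∀ n, LinearMap.range (d n) ≤ Ideal.ofList rs • (⊤ : Submodule Q (X n)))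
    {n : ℕ} (hn : rs.length < n) : Subsingleton (X n) := by
  obtain ⟨n, rfl⟩ : ∃ m, n = m + 1 := ⟨n - 1, by omega⟩
  refine subsingleton_of_ideal_smul_top_eq_top htop fun x => ?_
  obtain ⟨y, hy⟩ := exact_mod_of_isWeaklyRegular hdd hex hrs (by omega) (hd n ⟨x, rfl⟩)
  simpa using add_mem hy (hd (n + 1) ⟨y, rfl⟩)

/-- If a bounded free complex, exact in positive degrees and of length `p`, has its differentials in
`I`, then `I` has grade at least `p`: no nonzero element modulo a weakly regular sequence of fewer
than `p` elements is annihilated by `I`. -/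
lemma mem_ofList_of_forall_mul_mem [∀ n, Module.Free Q (X n)]
    {d : ∀ n, X (n + 1) →ₗ[Q] X n}
    (hdd : ∀ n x, d n (d (n + 1) x) = 0) (hex : ∀ n x, d n x = 0 → ∃ y, d (n + 1) y = x)
    {I : Ideal Q} (hd : ∀ n, LinearMap.range (d n) ≤ I • (⊤ : Submodule Q (X n)))
    {p : ℕ} [Nontrivial (X p)] [Subsingleton (X (p + 1))]
    {rs : List Q} (hrs : RingTheory.Sequence.IsWeaklyRegular Q rs) (hp : rs.length < p)
    {y : Q} (hy : ∀ a ∈ I, y * a ∈ Ideal.ofList rs) : y ∈ Ideal.ofList rs := by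
  obtain ⟨p, rfl⟩ : ∃ m, p = m + 1 := ⟨p - 1, by omega⟩
  refine mem_of_forall_smul_mem_ideal_smul_top (X := X (p + 1)) fun x => ?_
  have hx : d p (y • x) ∈ Ideal.ofList rs • (⊤ : Submodule Q (X p)) := by
    rw [map_smul]
    refine Submodule.smul_induction_on (hd p ⟨x, rfl⟩) (fun a ha z _ => ?_) (fun z w hz hw => ?_)
    · rw [smul_smul]
      exact Submodule.smul_mem_smul (hy a ha) trivial
    · rw [smul_add]
      exact add_mem hz hw
  obtain ⟨z, hz⟩ := exact_mod_of_isWeaklyRegular hdd hex hrs (by omega) hx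
  simpa [Subsingleton.elim z 0] using hz

/-! ### Homotopies -/

/-- Multiplication by `f` is null-homotopic on a projective complex that is exact in positive
degrees and whose homology in degree zero is annihilated by `f`. -/
lemma exists_nullHomotopy_smul [∀ n, Module.Projective Q (X n)]
    {d : ∀ n, X (n + 1) →ₗ[Q] X n}
    (hdd : ∀ n x, d n (d (n + 1) x) = 0) (hex : ∀ n x, d n x = 0 → ∃ y, d (n + 1) y = x)
    {f : Q} (hf : ∀ x : X 0, ∃ y, d 0 y = f • x) :
    ∃ σ : ∀ n, X n →ₗ[Q] X (n + 1), (∀ x, d 0 (σ 0 x) = f • x) ∧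
      ∀ n x, d (n + 1) (σ (n + 1) x) = f • x - σ n (d n x) := by
  have lift : ∀ n (g : X n →ₗ[Q] X n), (∀ x, ∃ y, d n y = g x) →
      ∃ τ : X n →ₗ[Q] X (n + 1), ∀ x, d n (τ x) = g x := by
    intro n g hg
    obtain ⟨τ, hτ⟩ := Module.projective_lifting_property (d n).rangeRestrict
      (g.codRestrict (LinearMap.range (d n)) hg) (d n).surjective_rangeRestrict
    exact ⟨τ, fun x => congrArg Subtype.val (LinearMap.congr_fun hτ x)⟩
  -- The recursion carries the relation `d σ d = f d`, which makes `f x - σ d x` a cycle.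
  let S : ℕ → Type _ := fun n => {τ : X n →ₗ[Q] X (n + 1) // ∀ x, d n (τ (d n x)) = f • d n x}
  have step : ∀ n (τ : S n), ∃ τ' : S (n + 1), ∀ x, d (n + 1) (τ'.1 x) = f • x - τ.1 (d n x) := by
    intro n τ
    obtain ⟨τ', h'⟩ := lift (n + 1) (f • LinearMap.id - τ.1 ∘ₗ d n) fun x =>
      hex n _ (by simp [τ.2 x])
    have h'' : ∀ x, d (n + 1) (τ' x) = f • x - τ.1 (d n x) := fun x => by simpa using h' x
    exact ⟨⟨τ', fun x => by rw [h'', hdd, map_zero, sub_zero]⟩, h''⟩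
  choose next hnext using step
  obtain ⟨τ₀, h₀⟩ := lift 0 (f • LinearMap.id) fun x => by simpa using hf x
  have h₀' : ∀ x, d 0 (τ₀ x) = f • x := fun x => by simpa using h₀ x
  let σ : ∀ n, S n := fun n => Nat.rec ⟨τ₀, fun x => h₀' _⟩ next n
  exact ⟨fun n => (σ n).1, h₀', fun n x => hnext n (σ n) x⟩

/-- The value `σ_{j₁} ⋯ σ_{jₙ} e` of a word in operators of degree one. -/
def wordValue {ι : Type*} (σ : ι → ∀ n, X n →ₗ[Q] X (n + 1)) (e : X 0) :
    ∀ L : List ι, X L.length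
  | [] => e
  | j :: L => σ j L.length (wordValue σ e L)

/-- Under these hypotheses the word `σ₁ ⋯ σ_r e` in null-homotopies `σ_j` of multiplication by `f_j`
is nonzero modulo `m`. The ideal `K j` is to be thought of as the elements of `I` whose coefficient
at `f_j` vanishes modulo `m`; a chain with boundary in `K j` is one killed by the operator that
extracts from the boundary the coefficient at `f_j`. -/
lemma nontrivial_of_relations [∀ n, Module.Free Q (X n)]
    {d : ∀ n, X (n + 1) →ₗ[Q] X n}
    (hdd : ∀ n x, d n (d (n + 1) x) = 0) (hex : ∀ n x, d n x = 0 → ∃ y, d (n + 1) y = x)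
    {I m : Ideal Q} (hd : ∀ n, LinearMap.range (d n) ≤ I • (⊤ : Submodule Q (X n)))
    (hI : ∀ a ∈ I, ∀ x : X 0, ∃ y, d 0 y = a • x)
    {e : X 0} (he : e ∉ m • (⊤ : Submodule Q (X 0)))
    {r : ℕ} {f : Fin r → Q} (hf : ∀ j, f j ∈ I) {K : Fin r → Ideal Q}
    (hfK : ∀ j l, l ≠ j → f l ∈ K j) (hmK : ∀ j, m * I ≤ K j)
    (hK : ∀ j a, f j * a ∈ K j → a ∈ m) : Nontrivial (X r) := by
  choose σ hσ₀ hσ using fun j => exists_nullHomotopy_smul hdd hex (hI _ (hf j))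
  -- Words avoiding the letter `j` have their boundary in `K j`.
  have hbd : ∀ (j : Fin r) (l : Fin r) (L : List (Fin r)), j ∉ l :: L →
      d L.length (wordValue σ e (l :: L)) ∈ K j • (⊤ : Submodule Q (X L.length)) := by
    intro j l L
    induction L generalizing l with
    | nil =>
      intro hj
      rw [List.mem_singleton] at hj
      change d 0 (σ l 0 e) ∈ _
      rw [hσ₀]
      exact Submodule.smul_mem_smul (hfK j l (Ne.symm hj)) trivial
    | cons k L ih =>
      intro hj
      rw [List.mem_cons, not_or] at hj
      change d (L.length + 1) (σ l (L.length + 1) (wordValue σ e (k :: L))) ∈ _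
      rw [hσ]
      exact sub_mem (Submodule.smul_mem_smul (hfK j l (Ne.symm hj.1)) trivial)
        (map_mem_ideal_smul_top _ (ih k hj.2))
  have hne : ∀ L : List (Fin r), L.Nodup →
      wordValue σ e L ∉ m • (⊤ : Submodule Q (X L.length)) := by
    intro L
    induction L with
    | nil => exact fun _ => he
    | cons j L ih =>
      intro hL hmem
      rw [List.nodup_cons] at hL
      refine ih hL.2 (mem_ideal_smul_top_of_smul_mem (hK j) ?_)
      have h1 : d L.length (wordValue σ e (j :: L)) ∈ K j • (⊤ : Submodule Q (X L.length)) :=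
        Submodule.smul_mono_left (hmK j) (map_mem_mul_smul_top _ (hd _) hmem)
      cases L with
      | nil =>
        change d 0 (σ j 0 e) ∈ _ at h1
        rwa [hσ₀] at h1
      | cons k L =>
        change d (L.length + 1) (σ j (L.length + 1) (wordValue σ e (k :: L))) ∈ _ at h1
        rw [hσ] at h1
        simpa using add_mem h1 (map_mem_ideal_smul_top (σ j _) (hbd j k L hL.1))
  have hlen := hne (List.finRange r) (List.nodup_finRange r)
  rw [← List.length_finRange (n := r)]
  exact nontrivial_of_ne (wordValue σ e (List.finRange r)) 0 fun h => hlen (by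
    rw [h]
    exact zero_mem _)

end Complex

/-! ### Projective resolutions of modules -/

section Resolution

variable {Q : Type u} [CommRing Q] {M : ModuleCat.{v} Q} (F : ProjectiveResolution M)

lemma CategoryTheory.ProjectiveResolution.hom_d_d (n : ℕ) (x : F.complex.X (n + 2)) :
    (F.complex.d (n + 1) n).hom ((F.complex.d (n + 2) (n + 1)).hom x) = 0 := by
  rw [← ModuleCat.comp_apply, F.complex.d_comp_d]
  rfl

lemma CategoryTheory.ProjectiveResolution.exists_hom_d_eq (n : ℕ) (x : F.complex.X (n + 1))
    (hx : (F.complex.d (n + 1) n).hom x = 0) : ∃ y, (F.complex.d (n + 2) (n + 1)).hom y = x :=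
  (ShortComplex.moduleCat_exact_iff _).1 (F.exact_succ n) x hx

/-- The augmentation `F₀ → M` as a linear map. -/
noncomputable def CategoryTheory.ProjectiveResolution.augmentation : F.complex.X 0 →ₗ[Q] M :=
  (F.π.f 0).hom

lemma CategoryTheory.ProjectiveResolution.augmentation_surjective :
    Function.Surjective F.augmentation :=
  (ModuleCat.epi_iff_surjective (F.π.f 0)).1 inferInstance

lemma CategoryTheory.ProjectiveResolution.augmentation_eq_zero_iff (x : F.complex.X 0) :
    F.augmentation x = 0 ↔ ∃ y, (F.complex.d 1 0).hom y = x := by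
  constructor
  · exact (ShortComplex.moduleCat_exact_iff _).1 F.exact₀ x
  · rintro ⟨y, rfl⟩
    exact LinearMap.congr_fun (congrArg ModuleCat.Hom.hom F.complex_d_comp_π_f_zero) y

/-- A projective resolution that vanishes in degrees greater than `s` bounds the projective
dimension by `s`, since `Ext` classes are represented by cocycles on it. -/
lemma CategoryTheory.ProjectiveResolution.projectiveDimension_le [Small.{v} Q] {s : ℕ}
    (h : ∀ n, s < n → Subsingleton (F.complex.X n)) :
    projectiveDimension M ≤ (s : WithBot ℕ∞) := by
  rw [projectiveDimension_le_iff]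
  let := HasExt.standard (ModuleCat.{v} Q)
  refine HasProjectiveDimensionLT.mk fun i hi Y e => ?_
  obtain ⟨f, hf, rfl⟩ := F.extMk_surjective e (i + 1) rfl
  have := h i (by omega)
  obtain rfl : f = 0 := (ModuleCat.isZero_of_subsingleton _).eq_of_src _ _
  simp

end Resolution

/-! ### Prime avoidance and generic generators -/

/-- Prime avoidance for cosets: if no member of a finite set of primes contains `(f) + L`, then some
element of the coset `f + L` lies in none of them. -/
lemma exists_add_notMem_of_finset {Q : Type*} [CommRing Q] (S : Finset (Ideal Q))
    (hS : ∀ P ∈ S, P.IsPrime) {f : Q} {L : Ideal Q}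
    (h : ∀ P ∈ S, ¬ (f ∈ P ∧ L ≤ P)) : ∃ l ∈ L, ∀ P ∈ S, f + l ∉ P := by
  classical
  induction S using Finset.strongInduction with
  | H S ih =>
  obtain rfl | hne := S.eq_empty_or_nonempty
  · exact ⟨0, L.zero_mem, by simp⟩
  -- Minimality of `P` ensures that the intersection of the other primes is not contained in `P`.
  obtain ⟨P, hP⟩ := S.exists_minimal hne
  obtain ⟨l, hl, hlS⟩ := ih (S.erase P) (Finset.erase_ssubset hP.1)
    (fun P' h' => hS P' (Finset.mem_of_mem_erase h'))
    (fun P' h' => h P' (Finset.mem_of_mem_erase h'))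
  by_cases hfl : f + l ∈ P
  · have hnot : ¬ L ⊓ (S.erase P).inf id ≤ P := by
      rw [(hS P hP.1).inf_le, (hS P hP.1).inf_le', not_or]
      refine ⟨fun hLP => h P hP.1 ⟨by simpa using P.sub_mem hfl (hLP hl), hLP⟩, ?_⟩
      rintro ⟨P', h', hle⟩
      exact Finset.ne_of_mem_erase h' (le_antisymm hle (hP.2 (Finset.mem_of_mem_erase h') hle))
    obtain ⟨r, ⟨hrL, hr⟩, hrP⟩ := SetLike.not_le_iff_exists.1 hnot
    refine ⟨l + r, L.add_mem hl hrL, fun P' h' => ?_⟩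
    rw [← add_assoc]
    by_cases hPP : P' = P
    · subst hPP
      exact fun hmem => hrP (by simpa using P'.sub_mem hmem hfl)
    · have h'' := Finset.mem_erase.2 ⟨hPP, h'⟩
      have hrP' : r ∈ P' := (Finset.inf_le (f := id) h'' : _ ≤ P') hr
      exact fun hmem => hlS P' h'' (by simpa using P'.sub_mem hmem hrP')
  · refine ⟨l, hl, fun P' h' => ?_⟩
    by_cases hPP : P' = P
    · rwa [hPP]
    · exact hlS P' (Finset.mem_erase.2 ⟨hPP, h'⟩)

/-- The list `xs` arises from `fs` by a unipotent upper triangular change: each entry of `xs` is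
the corresponding entry of `fs` plus a combination of the later entries of `fs`. -/
inductive IsUnitriangularChange {Q : Type*} [CommRing Q] : List Q → List Q → Prop
  | nil : IsUnitriangularChange [] []
  | cons {f x : Q} {fs xs : List Q} (h : x - f ∈ Ideal.ofList fs)
      (hs : IsUnitriangularChange fs xs) : IsUnitriangularChange (f :: fs) (x :: xs)

lemma span_singleton_sup_eq_of_sub_mem {Q : Type*} [CommRing Q] {x f : Q} {J : Ideal Q}
    (h : x - f ∈ J) : Ideal.span {x} ⊔ J = Ideal.span {f} ⊔ J := by
  apply le_antisymm
  · refine sup_le ((Ideal.span_singleton_le_iff_mem _).2 ?_) le_sup_right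
    rw [← sub_add_cancel x f]
    exact add_mem (Ideal.mem_sup_right h) (Ideal.mem_sup_left (Ideal.mem_span_singleton_self f))
  · refine sup_le ((Ideal.span_singleton_le_iff_mem _).2 ?_) le_sup_right
    rw [← sub_sub_cancel x f]
    exact sub_mem (Ideal.mem_sup_left (Ideal.mem_span_singleton_self x)) (Ideal.mem_sup_right h)

lemma IsUnitriangularChange.ofList_eq {Q : Type*} [CommRing Q] {fs xs : List Q}
    (h : IsUnitriangularChange fs xs) : Ideal.ofList xs = Ideal.ofList fs := by
  induction h with
  | nil => rfl
  | cons h hs ih =>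
    rw [Ideal.ofList_cons, Ideal.ofList_cons, ih, span_singleton_sup_eq_of_sub_mem h]

lemma IsUnitriangularChange.map {Q R : Type*} [CommRing Q] [CommRing R] (φ : Q →+* R)
    {fs xs : List Q} (h : IsUnitriangularChange fs xs) :
    IsUnitriangularChange (fs.map φ) (xs.map φ) := by
  induction h with
  | nil => exact .nil
  | cons h hs ih =>
    refine .cons ?_ ih
    rw [← Ideal.map_ofList, ← map_sub]
    exact Ideal.mem_map_of_mem φ h

lemma Ideal.ofList_reverse {Q : Type*} [CommRing Q] (rs : List Q) :
    Ideal.ofList rs.reverse = Ideal.ofList rs := by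
  simp [Ideal.ofList]

lemma RingTheory.Sequence.isWeaklyRegular_append_singleton_iff {Q : Type*} [CommRing Q]
    (rs : List Q) (r : Q) :
    RingTheory.Sequence.IsWeaklyRegular Q (rs ++ [r]) ↔
      RingTheory.Sequence.IsWeaklyRegular Q rs ∧
        ∀ a, r * a ∈ Ideal.ofList rs → a ∈ Ideal.ofList rs := by
  rw [isWeaklyRegular_append_iff, isWeaklyRegular_singleton_iff,
    isSMulRegular_quotient_iff_mem_of_smul_mem]
  simp

/-- Weak regularity descends along a unitriangular change in the reversed order, because there each
entry is changed only by a combination of the entries that precede it. -/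
lemma IsUnitriangularChange.isWeaklyRegular_reverse {Q : Type*} [CommRing Q] {fs xs : List Q}
    (h : IsUnitriangularChange fs xs)
    (hxs : RingTheory.Sequence.IsWeaklyRegular Q xs.reverse) :
    RingTheory.Sequence.IsWeaklyRegular Q fs.reverse := by
  induction h with
  | nil => exact hxs
  | cons h hs ih =>
    rw [List.reverse_cons, RingTheory.Sequence.isWeaklyRegular_append_singleton_iff,
      Ideal.ofList_reverse] at hxs ⊢
    rw [hs.ofList_eq] at hxs
    refine ⟨ih hxs.1, fun a ha => hxs.2 a ?_⟩
    rw [← add_sub_cancel_right (_ * a) (_ * a), add_sub_right_comm, ← sub_mul]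
    exact add_mem (Ideal.mul_mem_right _ _ h) ha

/-- If `I` has grade at least `N` and is generated by `ys` and `fs`, of total length at most `N`,
then a weakly regular sequence `ys` can be continued by a unitriangular change of `fs`. -/
lemma exists_isUnitriangularChange_isWeaklyRegular {Q : Type*} [CommRing Q] [IsNoetherianRing Q]
    {I : Ideal Q} {N : ℕ}
    (hN : ∀ rs : List Q, RingTheory.Sequence.IsWeaklyRegular Q rs → rs.length < N →
      ∀ y, (∀ a ∈ I, y * a ∈ Ideal.ofList rs) → y ∈ Ideal.ofList rs)
    (fs ys : List Q) (hI : Ideal.ofList ys ⊔ Ideal.ofList fs = I)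
    (hlen : ys.length + fs.length ≤ N) (hys : RingTheory.Sequence.IsWeaklyRegular Q ys) :
    ∃ xs, IsUnitriangularChange fs xs ∧ RingTheory.Sequence.IsWeaklyRegular Q (ys ++ xs) := by
  induction fs generalizing ys with
  | nil => exact ⟨[], .nil, by simpa using hys⟩
  | cons f fs ih =>
    have hfin := associatedPrimes.finite Q (Q ⧸ Ideal.ofList ys)
    have hprime : ∀ P ∈ hfin.toFinset, P.IsPrime := fun P hP =>
      IsAssociatedPrime.isPrime (hfin.mem_toFinset.1 hP)
    obtain ⟨l, hl, hlP⟩ := exists_add_notMem_of_finset hfin.toFinset hprime (f := f)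
        (L := Ideal.ofList fs) (by
      rintro P hP ⟨hfP, hLP⟩
      obtain ⟨-, z, hz⟩ := isAssociatedPrime_iff.1 (hfin.mem_toFinset.1 hP)
      obtain ⟨y, rfl⟩ := Ideal.Quotient.mk_surjective z
      have hmem : ∀ a, a ∈ P ↔ y * a ∈ Ideal.ofList ys := by
        intro a
        rw [hz, Submodule.mem_colon_singleton, Submodule.mem_bot, Algebra.smul_def,
          Ideal.Quotient.algebraMap_eq, ← map_mul, Ideal.Quotient.eq_zero_iff_mem, mul_comm]
      -- `P` contains `I`, so `y` multiplies `I` into `(ys)`, and hence lies in it.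
      have hIP : I ≤ P := by
        rw [← hI, Ideal.ofList_cons]
        refine sup_le (fun a ha => (hmem a).2 (Ideal.mul_mem_left _ _ ha))
          (sup_le ((Ideal.span_singleton_le_iff_mem _).2 hfP) hLP)
      have hy := hN ys hys (by simp only [List.length_cons] at hlen; omega) y
        fun a ha => (hmem a).1 (hIP ha)
      exact (hprime P hP).ne_top ((Ideal.eq_top_iff_one _).2 ((hmem 1).2 (by simpa using hy))))
    have hreg : ∀ a, (f + l) * a ∈ Ideal.ofList ys → a ∈ Ideal.ofList ys := by
      have hnot : f + l ∉ ⋃ p ∈ associatedPrimes Q (Q ⧸ Ideal.ofList ys), (p : Set Q) := by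
        simpa using hlP
      rw [biUnion_associatedPrimes_eq_compl_regular, Set.notMem_compl_iff] at hnot
      exact (isSMulRegular_quotient_iff_mem_of_smul_mem _ _).1 hnot
    have hsub : f + l - f ∈ Ideal.ofList fs := by simpa using hl
    obtain ⟨xs, hxs, hreg'⟩ := ih (ys ++ [f + l])
      (by rw [← hI, Ideal.ofList_append, Ideal.ofList_singleton, Ideal.ofList_cons, sup_assoc,
            span_singleton_sup_eq_of_sub_mem hsub])
      (by simp only [List.length_append, List.length_cons, List.length_nil] at hlen ⊢; omega)
      ((RingTheory.Sequence.isWeaklyRegular_append_singleton_iff _ _).2 ⟨hys, hreg⟩)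
    exact ⟨(f + l) :: xs, .cons hsub hxs, by simpa using hreg'⟩

/-! ### Generators read off from a resolution -/

section Generators

variable {Q : Type u} [CommRing Q]

/-- A minimal free resolution of the nonzero cyclic module `Q / I` starts with a module of rank one,
since `F₀ / m F₀` is cyclic. -/
lemma unique_index_of_minimal {I m : Ideal Q} (hm : m ≠ ⊤) (hI : I ≠ ⊤)
    (F : ProjectiveResolution (ModuleCat.of Q (Q ⧸ I))) (hF : DifferentialsLandIn F m)
    {ι : Type*} (b : Module.Basis ι Q (F.complex.X 0)) : Nonempty (Unique ι) := by
  obtain ⟨e, he⟩ := F.augmentation_surjective (show Q ⧸ I from 1)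
  -- Modulo `m`, every element of `F₀` is a multiple of the lift `e` of `1`.
  have hcong : ∀ x : F.complex.X 0, ∃ a : Q, ∀ i, b.repr x i - a * b.repr e i ∈ m := by
    intro x
    obtain ⟨a, ha⟩ := Ideal.Quotient.mk_surjective (I := I) (F.augmentation x)
    have h0 : F.augmentation (x - a • e) = 0 := by
      rw [map_sub, map_smul, he, ← ha]
      change Ideal.Quotient.mk I a - a • (1 : Q ⧸ I) = 0
      rw [Algebra.smul_def, mul_one]
      exact sub_self _
    have := hF 0 ((F.augmentation_eq_zero_iff _).1 h0)
    exact ⟨a, fun i => by simpa using (b.mem_ideal_smul_top_iff_repr m _).1 this i⟩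
  have hne : Nonempty ι := by
    by_contra hempty
    rw [not_nonempty_iff] at hempty
    have := b.repr.toEquiv.subsingleton
    have h10 : (1 : Q ⧸ I) = 0 := by
      rw [Subsingleton.elim e 0, map_zero] at he
      exact he.symm
    exact hI ((Ideal.eq_top_iff_one I).2 (Ideal.Quotient.eq_zero_iff_mem.1 h10))
  have hsub : ∀ i j : ι, i = j := by
    intro i j
    by_contra hij
    obtain ⟨a, ha⟩ := hcong (b i)
    obtain ⟨c, hc⟩ := hcong (b j)
    have h1 := ha i
    have h2 := ha j
    have h3 := hc j
    have h4 := hc i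
    rw [b.repr_self, Finsupp.single_eq_same] at h1 h3
    rw [b.repr_self, Finsupp.single_eq_of_ne (Ne.symm hij), zero_sub, neg_mem_iff] at h2
    rw [b.repr_self, Finsupp.single_eq_of_ne hij, zero_sub, neg_mem_iff] at h4
    refine hm ((Ideal.eq_top_iff_one m).2 ?_)
    have key : (1 : Q) = (1 - a * b.repr e i) + a * b.repr e i * (1 - c * b.repr e j) +
      a * b.repr e j * (c * b.repr e i) := by ring
    rw [key]
    exact add_mem (add_mem h1 (m.mul_mem_left _ h3)) (m.mul_mem_left _ h4)
  obtain ⟨i⟩ := hne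
  exact ⟨⟨⟨i⟩, fun j => hsub j i⟩⟩

/-- A bounded minimal free resolution of `Q / I` with differentials in `I` yields generators of `I`,
the entries of the first differential, that become a weakly regular sequence after a unitriangular
change. -/
theorem exists_generators_isUnitriangularChange [IsNoetherianRing Q] {I m : Ideal Q}
    (hm : m ≠ ⊤) (hI : I ≠ ⊤)
    (F : ProjectiveResolution (ModuleCat.of Q (Q ⧸ I))) (hfree : IsFreeResolution F)
    (hFm : DifferentialsLandIn F m) (hFI : DifferentialsLandIn F I) {s : ℕ}
    (hs : ∀ n, s < n → Subsingleton (F.complex.X n))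
    {ι : Type*} (b₀ : Module.Basis ι Q (F.complex.X 0))
    {r : ℕ} (b₁ : Module.Basis (Fin r) Q (F.complex.X 1)) :
    ∃ (i : ι) (fs xs : List Q),
      fs = List.ofFn (fun j => b₀.repr ((F.complex.d 1 0).hom (b₁ j)) i) ∧
      Ideal.ofList fs = I ∧ IsUnitriangularChange fs xs ∧
      RingTheory.Sequence.IsWeaklyRegular Q xs := by
  obtain ⟨hu⟩ := unique_index_of_minimal hm hI F hFm b₀
  let i : ι := default
  let X : ℕ → Type u := fun n => F.complex.X n
  let d : ∀ n, X (n + 1) →ₗ[Q] X n := fun n => (F.complex.d (n + 1) n).hom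
  have hfree' : ∀ n, Module.Free Q (X n) := hfree
  have hdd : ∀ n x, d n (d (n + 1) x) = 0 := F.hom_d_d
  have hex : ∀ n x, d n x = 0 → ∃ y, d (n + 1) y = x := F.exists_hom_d_eq
  let φ : X 1 →ₗ[Q] Q := b₀.coord i ∘ₗ d 0
  have hφ : ∀ x, d 0 x = φ x • b₀ i := by
    intro x
    refine b₀.repr.injective (Finsupp.ext fun k => ?_)
    rw [Unique.eq_default k]
    simp [φ, i]
  have haug : ∀ a ∈ I, ∀ x : X 0, ∃ y, d 0 y = a • x := by
    intro a ha x
    refine (F.augmentation_eq_zero_iff _).1 ?_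
    obtain ⟨c, hc⟩ := Ideal.Quotient.mk_surjective (I := I) (F.augmentation x)
    rw [map_smul, ← hc]
    change a • Ideal.Quotient.mk I c = 0
    rw [Algebra.smul_def, Ideal.Quotient.algebraMap_eq, ← map_mul,
      Ideal.Quotient.eq_zero_iff_mem]
    exact I.mul_mem_right _ ha
  have hrange : LinearMap.range φ = I := by
    ext a
    constructor
    · rintro ⟨x, rfl⟩
      obtain ⟨e, he⟩ := F.augmentation_surjective (show Q ⧸ I from 1)
      have he' : e = b₀.repr e i • b₀ i := by
        refine b₀.repr.injective (Finsupp.ext fun k => ?_)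
        rw [Unique.eq_default k]
        simp [i]
      have h0 : F.augmentation (φ x • e) = 0 := by
        rw [he', smul_comm, ← hφ, map_smul, (F.augmentation_eq_zero_iff _).2 ⟨x, rfl⟩, smul_zero]
      rw [map_smul, he] at h0
      change φ x • (1 : Q ⧸ I) = 0 at h0
      rwa [Algebra.smul_def, mul_one, Ideal.Quotient.algebraMap_eq,
        Ideal.Quotient.eq_zero_iff_mem] at h0
    · intro ha
      obtain ⟨y, hy⟩ := haug a ha (b₀ i)
      exact ⟨y, by simp [φ, hy]⟩
  let f : Fin r → Q := fun j => φ (b₁ j)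
  have hfI : ∀ j, f j ∈ I := fun j => hrange ▸ ⟨b₁ j, rfl⟩
  have hgen : Ideal.ofList (List.ofFn f) = I := by
    rw [← hrange, LinearMap.range_eq_map, ← b₁.span_eq, Submodule.map_span, ← Set.range_comp]
    simp only [Ideal.ofList, List.mem_ofFn', Ideal.span]
    rfl
  -- Combinations of the generators whose `j`-th coefficient lies in `m`.
  let K : Fin r → Ideal Q := fun j => Submodule.map φ (Submodule.comap (b₁.coord j) m)
  -- The number `r` of generators is at most the length `p` of the resolution.
  have hnt : Nontrivial (X r) := by
    refine nontrivial_of_relations hdd hex (I := I) (m := m) hFI haug (e := b₀ i) ?_ hfI (K := K)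
      ?_ ?_ ?_
    · intro h
      refine hm ((Ideal.eq_top_iff_one m).2 ?_)
      simpa using (b₀.mem_ideal_smul_top_iff_repr m _).1 h i
    · intro j l hlj
      exact ⟨b₁ l, by simp [Finsupp.single_eq_of_ne (Ne.symm hlj)], rfl⟩
    · intro j
      refine Ideal.mul_le.2 fun a ha c hc => ?_
      rw [← hrange] at hc
      obtain ⟨x, rfl⟩ := hc
      exact ⟨a • x, by simpa using m.mul_mem_right _ ha, by simp⟩
    · rintro j a ⟨x, hx, hxa⟩
      have h0 : d 0 (a • b₁ j - x) = 0 := by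
        rw [hφ, map_sub, map_smul, hxa, smul_eq_mul, mul_comm, sub_self, zero_smul]
      have h1 := (b₁.mem_ideal_smul_top_iff_repr m _).1 (hFm 1 (hex 0 _ h0)) j
      rw [map_sub, map_smul, b₁.repr_self] at h1
      have hx' : b₁.repr x j ∈ m := hx
      simpa using m.add_mem h1 hx'
  classical
  let p := Nat.findGreatest (fun n => Nontrivial (X n)) s
  have hrs : r ≤ s := by
    by_contra hlt
    have := hs r (by omega)
    exact not_nontrivial (X r) hnt
  have hp : Nontrivial (X p) :=
    Nat.findGreatest_spec (P := fun n => Nontrivial (X n)) hrs hnt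
  have hrp : r ≤ p := Nat.le_findGreatest hrs hnt
  have hp1 : Subsingleton (X (p + 1)) := by
    by_cases hle : p + 1 ≤ s
    · exact not_nontrivial_iff_subsingleton.1
        (Nat.findGreatest_is_greatest (P := fun n => Nontrivial (X n)) (Nat.lt_succ_self p) hle)
    · exact hs _ (by omega)
  obtain ⟨xs, hxs, hreg⟩ := exists_isUnitriangularChange_isWeaklyRegular (I := I) (N := p)
    (fun rs hrs hlt y hy => mem_ofList_of_forall_mul_mem hdd hex hFI hrs hlt hy)
    (List.ofFn f) [] (by simpa using hgen) (by simpa using hrp) (.nil Q Q)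
  exact ⟨i, List.ofFn f, xs, rfl, hgen, hxs, by simpa using hreg⟩

end Generators

/-! ### The homogeneous maximal ideal -/

lemma isHomogeneous_ofList {Q : Type u} [CommRing Q] (𝒜 : ℕ → AddSubgroup Q) [GradedRing 𝒜]
    {rs : List Q} (h : ∀ x ∈ rs, SetLike.IsHomogeneousElem 𝒜 x) :
    (Ideal.ofList rs).IsHomogeneous 𝒜 :=
  Ideal.homogeneous_span 𝒜 _ h

lemma isHomogeneousElem_of_mem_gradedComponent {Q : Type u} [CommRing Q]
    (𝒜 : ℕ → AddSubgroup Q) {n : ℤ} {x : Q} (h : x ∈ gradedComponent 𝒜 n) :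
    SetLike.IsHomogeneousElem 𝒜 x := by
  cases n with
  | ofNat n => exact ⟨n, h⟩
  | negSucc n =>
    obtain rfl : x = 0 := h
    exact ⟨0, zero_mem _⟩

section Graded

open DirectSum

variable {Q : Type u} [CommRing Q] (𝒜 : ℕ → AddSubgroup Q) [GradedRing 𝒜] [IsLocalRing (𝒜 0)]

lemma gradedMaximalIdeal_isMaximal : (gradedMaximalIdeal 𝒜).IsMaximal :=
  Ideal.comap_isMaximal_of_surjective _ (GradedRing.projZeroRingHom'_surjective 𝒜)

lemma isUnit_coe_decompose_zero {s : Q} (hs : s ∉ gradedMaximalIdeal 𝒜) :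
    IsUnit (decompose 𝒜 s 0 : Q) := by
  have h : IsUnit (GradedRing.projZeroRingHom' 𝒜 s) := by
    by_contra h
    exact hs ((IsLocalRing.mem_maximalIdeal _).2 h)
  exact h.map (SetLike.GradeZero.subring 𝒜).subtype

lemma le_gradedMaximalIdeal {I : Ideal Q} (hI : I.IsHomogeneous 𝒜) (htop : I ≠ ⊤) :
    I ≤ gradedMaximalIdeal 𝒜 := fun _ ha => by
  by_contra h
  exact htop (I.eq_top_of_isUnit_mem (hI 0 ha) (isUnit_coe_decompose_zero 𝒜 h))

/-- The degree zero component of `s` is a unit, and its product with `z` is the component of `s * z`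
in the degree of `z`. -/
lemma mem_of_mul_mem_of_notMem_gradedMaximalIdeal {J : Ideal Q} (hJ : J.IsHomogeneous 𝒜)
    {s z : Q} (hs : s ∉ gradedMaximalIdeal 𝒜) {n : ℕ} (hz : z ∈ 𝒜 n) (h : s * z ∈ J) :
    z ∈ J := by
  have h0 := hJ (0 + n) h
  rw [coe_decompose_mul_add_of_right_mem 𝒜 hz] at h0
  exact (Ideal.unit_mul_mem_iff_mem J (isUnit_coe_decompose_zero 𝒜 hs)).1 h0

/-- Weak regularity of a sequence of homogeneous elements can be tested in the localization at the
homogeneous maximal ideal. -/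
lemma isWeaklyRegular_of_map_localization {R : Type*} [CommRing R] [Algebra Q R]
    [(gradedMaximalIdeal 𝒜).IsPrime] [IsLocalization.AtPrime R (gradedMaximalIdeal 𝒜)]
    {rs : List Q} (hrs : ∀ x ∈ rs, SetLike.IsHomogeneousElem 𝒜 x)
    (h : RingTheory.Sequence.IsWeaklyRegular R (rs.map (algebraMap Q R))) :
    RingTheory.Sequence.IsWeaklyRegular Q rs := by
  induction rs using List.reverseRecOn with
  | nil => exact .nil Q Q
  | append_singleton rs r ih =>
    rw [List.map_append, List.map_singleton,
      RingTheory.Sequence.isWeaklyRegular_append_singleton_iff] at h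
    rw [RingTheory.Sequence.isWeaklyRegular_append_singleton_iff]
    have hrs' : ∀ x ∈ rs, SetLike.IsHomogeneousElem 𝒜 x := fun x hx => hrs x (by simp [hx])
    have hJ := isHomogeneous_ofList 𝒜 hrs'
    obtain ⟨e, he⟩ := hrs r (by simp)
    refine ⟨ih hrs' h.1, fun a ha => (hJ.mem_iff 𝒜).2 fun n => ?_⟩
    have hcomp := hJ (e + n) ha
    rw [coe_decompose_mul_add_of_left_mem 𝒜 he] at hcomp
    have hmap := h.2 (algebraMap Q R (decompose 𝒜 a n)) (by
      rw [← map_mul, ← Ideal.map_ofList]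
      exact Ideal.mem_map_of_mem _ hcomp)
    rw [← Ideal.map_ofList,
      IsLocalization.algebraMap_mem_map_algebraMap_iff (gradedMaximalIdeal 𝒜).primeCompl] at hmap
    obtain ⟨s, hs, hmem⟩ := hmap
    exact mem_of_mul_mem_of_notMem_gradedMaximalIdeal 𝒜 hJ hs (SetLike.coe_mem _) hmem

end Graded

/-! ### Weak complete intersection modules and ideals -/

section WeakCI

variable {Q : Type u} [CommRing Q]

lemma DifferentialsLandIn.mono {M : ModuleCat.{v} Q} {F : ProjectiveResolution M} {J K : Ideal Q}
    (h : DifferentialsLandIn F J) (hJK : J ≤ K) : DifferentialsLandIn F K :=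
  fun n => (h n).trans (Submodule.smul_mono_left hJK)

lemma DifferentialsLandIn.subsingleton {M : ModuleCat.{v} Q} {F : ProjectiveResolution M}
    (hfree : IsFreeResolution F) {g : List Q} (hg : RingTheory.Sequence.IsRegular Q g)
    (h : DifferentialsLandIn F (Ideal.ofList g)) {n : ℕ} (hn : g.length < n) :
    Subsingleton (F.complex.X n) := by
  have : ∀ n, Module.Free Q (F.complex.X n) := hfree
  exact subsingleton_of_range_le_isWeaklyRegular (X := fun n => F.complex.X n)
    (d := fun n => (F.complex.d (n + 1) n).hom) F.hom_d_d F.exists_hom_d_eq hg.toIsWeaklyRegular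
    (fun h => hg.top_ne_smul (by simp [h])) h hn

theorem IsSeqWeakCIModule.projectiveDimension_le {g : List Q}
    (hg : RingTheory.Sequence.IsRegular Q g) {M : Type v} [AddCommGroup M] [Module Q M]
    [Small.{v} Q] (hM : IsSeqWeakCIModule g M) :
    projectiveDimension (ModuleCat.of Q M) ≤ ((g.length : ℕ) : WithBot ℕ∞) := by
  obtain ⟨-, F, hfree, hF⟩ := hM
  exact F.projectiveDimension_le fun n hn => hF.subsingleton hfree hg hn

/-- As `I` annihilates `Q / I`, it maps the term `G₀` of a resolution into the image of the
differential, hence into `(g) G₀`. -/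
lemma IsSeqWeakCIIdeal.le_ofList {g : List Q} {I : Ideal Q} (hI : I ≠ ⊤)
    (h : IsSeqWeakCIIdeal g I) : I ≤ Ideal.ofList g := by
  obtain ⟨-, G, hfree, hG⟩ := h
  have := hfree 0
  have hnt : Nontrivial (Q ⧸ I) := Ideal.Quotient.nontrivial_iff.2 hI
  have : Nontrivial (G.complex.X 0) :=
    Function.Surjective.nontrivial (β := Q ⧸ I) G.augmentation_surjective
  intro a ha
  refine mem_of_forall_smul_mem_ideal_smul_top (X := G.complex.X 0) fun x => ?_
  refine hG 0 ((G.augmentation_eq_zero_iff _).1 ?_)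
  obtain ⟨c, hc⟩ := Ideal.Quotient.mk_surjective (I := I) (G.augmentation x)
  rw [map_smul, ← hc]
  change a • Ideal.Quotient.mk I c = 0
  rw [Algebra.smul_def, Ideal.Quotient.algebraMap_eq, ← map_mul, Ideal.Quotient.eq_zero_iff_mem]
  exact I.mul_mem_right _ ha

lemma isSeqWeakCIIdeal_of_le {g : List Q} {I : Ideal Q}
    {F : ProjectiveResolution (ModuleCat.of Q (Q ⧸ I))} (hfree : IsFreeResolution F)
    (hF : DifferentialsLandIn F I) (hI : I ≤ Ideal.ofList g) : IsSeqWeakCIIdeal g I :=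
  ⟨inferInstance, F, hfree, hF.mono hI⟩

lemma isRegular_of_isWeaklyRegular {rs : List Q}
    (h : RingTheory.Sequence.IsWeaklyRegular Q rs) (htop : Ideal.ofList rs ≠ ⊤) :
    RingTheory.Sequence.IsRegular Q rs :=
  ⟨h, fun h' => htop (by simpa using h'.symm)⟩

theorem IsWeakCIIdeal.isCIIdeal [IsNoetherianRing Q] [IsLocalRing Q] {g : List Q}
    (hg : RingTheory.Sequence.IsRegular Q g) {I : Ideal Q} (hI : I ≠ ⊤) (h : IsWeakCIIdeal I)
    (hle : I ≤ Ideal.ofList g) : IsCIIdeal I := by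
  obtain ⟨F, ⟨hfree, hfin, hFm⟩, hFI⟩ := h
  have := hfree 0
  have := hfree 1
  have := hfin 1
  obtain ⟨-, fs, xs, -, hfs, hxs, hreg⟩ := exists_generators_isUnitriangularChange
    (IsLocalRing.maximalIdeal.isMaximal Q).ne_top hI F hfree hFm hFI
    (fun n hn => (hFI.mono hle).subsingleton hfree hg hn)
    (Module.Free.chooseBasis Q (F.complex.X 0)) (Module.finBasis Q (F.complex.X 1))
  rw [← hxs.ofList_eq] at hfs
  exact ⟨xs, isRegular_of_isWeaklyRegular hreg (hfs ▸ hI), hfs⟩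

theorem IsGradedWeakCIIdeal.isGradedCIIdeal [IsNoetherianRing Q] (𝒜 : ℕ → AddSubgroup Q)
    [GradedRing 𝒜] [IsLocalRing (𝒜 0)] {g : List Q}
    (hg : RingTheory.Sequence.IsRegular Q g) {I : Ideal Q} (hI : I ≠ ⊤)
    (h : IsGradedWeakCIIdeal 𝒜 I) (hle : I ≤ Ideal.ofList g) : IsGradedCIIdeal 𝒜 I := by
  obtain ⟨hIhom, F, ⟨G⟩, ⟨hfree, -, hFm⟩, hFI⟩ := h
  have hmax := gradedMaximalIdeal_isMaximal 𝒜
  have hprime := hmax.isPrime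
  obtain ⟨i, fs, xs, rfl, hfs, hxs, hreg⟩ := exists_generators_isUnitriangularChange
    hmax.ne_top hI F hfree hFm hFI (fun n hn => (hFI.mono hle).subsingleton hfree hg hn)
    (G.basis 0) (G.basis 1)
  set fs : List Q := List.ofFn fun j => (G.basis 0).repr ((F.complex.d 1 0).hom (G.basis 1 j)) i
  have hhom : ∀ x ∈ fs.reverse, SetLike.IsHomogeneousElem 𝒜 x := by
    intro x hx
    rw [List.mem_reverse, List.mem_ofFn'] at hx
    obtain ⟨j, rfl⟩ := hx
    exact isHomogeneousElem_of_mem_gradedComponent 𝒜 (G.differential_homogeneous 0 j i)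
  let R := Localization.AtPrime (gradedMaximalIdeal 𝒜)
  have hxm : ∀ x ∈ xs.map (algebraMap Q R), x ∈ IsLocalRing.maximalIdeal R := by
    intro x hx
    obtain ⟨y, hy, rfl⟩ := List.mem_map.1 hx
    refine (IsLocalization.AtPrime.to_map_mem_maximal_iff R (gradedMaximalIdeal 𝒜) y).2
      (le_gradedMaximalIdeal 𝒜 hIhom hI ?_)
    rw [← hfs, ← hxs.ofList_eq]
    exact Ideal.subset_span hy
  have hregR := (hreg.of_isLocalization R (gradedMaximalIdeal 𝒜).primeCompl)
  have hrev := IsLocalRing.isWeaklyRegular_of_perm_of_subset_maximalIdeal hregR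
    (List.reverse_perm _).symm hxm
  have hfR := (hxs.map (algebraMap Q R)).isWeaklyRegular_reverse hrev
  rw [← List.map_reverse] at hfR
  rw [← Ideal.ofList_reverse] at hfs
  exact ⟨fs.reverse, ⟨isRegular_of_isWeaklyRegular
    (isWeaklyRegular_of_map_localization 𝒜 hhom hfR) (hfs ▸ hI), hhom⟩, hfs⟩

end WeakCI

theorem proposition2p4 :
    -- the local case
    (∀ (Q : Type u) [CommRing Q] [IsNoetherianRing Q] [IsLocalRing Q] (g : List Q),
      RingTheory.Sequence.IsRegular Q g →
        (∀ (M : Type v) [AddCommGroup M] [Module Q M] [Small.{v} Q], IsSeqWeakCIModule g M →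
          projectiveDimension (ModuleCat.of Q M) ≤ ((g.length : ℕ) : WithBot ℕ∞)) ∧
        (∀ I : Ideal Q, I ≠ ⊤ → IsWeakCIIdeal I →
          (IsSeqWeakCIIdeal g I ↔ IsCIIdeal I ∧ I ≤ Ideal.ofList g))) ∧
    -- the graded case
    (∀ (Q : Type u) [CommRing Q] [IsNoetherianRing Q] (𝒜 : ℕ → AddSubgroup Q) [GradedRing 𝒜]
      [IsLocalRing (𝒜 0)] (g : List Q),
      IsHomogeneousRegular 𝒜 g →
        (∀ (M : Type v) [AddCommGroup M] [Module Q M] [Small.{v} Q], IsSeqWeakCIModule g M →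
          projectiveDimension (ModuleCat.of Q M) ≤ ((g.length : ℕ) : WithBot ℕ∞)) ∧
        (∀ I : Ideal Q, I ≠ ⊤ → IsGradedWeakCIIdeal 𝒜 I →
          (IsSeqWeakCIIdeal g I ↔ IsGradedCIIdeal 𝒜 I ∧ I ≤ Ideal.ofList g))) := by
  refine ⟨fun Q _ _ _ g hg => ⟨fun M _ _ _ hM => hM.projectiveDimension_le hg,
    fun I hI hwci => ⟨fun h => ?_, fun h => ?_⟩⟩,
    fun Q _ _ 𝒜 _ _ g hg => ⟨fun M _ _ _ hM => hM.projectiveDimension_le hg.1,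
    fun I hI hwci => ⟨fun h => ?_, fun h => ?_⟩⟩⟩
  · exact ⟨hwci.isCIIdeal hg hI (h.le_ofList hI), h.le_ofList hI⟩
  · obtain ⟨F, ⟨hfree, -, -⟩, hF⟩ := hwci
    exact isSeqWeakCIIdeal_of_le hfree hF h.2
  · exact ⟨hwci.isGradedCIIdeal 𝒜 hg.1 hI (h.le_ofList hI), h.le_ofList hI⟩
  · obtain ⟨-, F, -, ⟨hfree, -, -⟩, hF⟩ := hwci
    exact isSeqWeakCIIdeal_of_le hfree hF h.2
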